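/- A \emph{full brick} has ten vertices. Its boundary is a cycle made of a bottom path $p_0, m, \alpha, \beta, \gamma, \delta, p_1$, a top path $q_0, n, \omega$, a left edge $p_0q_0$ and a right edge $p_1\omega$; in addition it has the four edges $\omega\alpha, \omega\beta, \omega\gamma, \omega\delta$ and the two crossing edges $\alpha\gamma$ and $\beta\delta$. For an integer $R \ge 0$, an \emph{$R$-counterwall} $G_R$ is obtained by arranging full bricks as in an $R$-wall: there are $R$ horizontal rows of $R$ consecutive bricks each, horizontally consecutive bricks share a side, and every other row is shifted to the right by half a brick (either the rows of even index or those of odd index). When a brick $A$ lies over the left half of the top path of a brick $B$, the edge $q_0n$ of $B$ is replaced by the right half $m, \alpha, \beta, \gamma, \delta, p_1$ of the bottom path of $A$, with $m$ of $A$ identified with $q_0$ of $B$, and $p_1$ of $A$ with $n$ of $B$. When $A$ lies over the right half of the top path of $B$, the edge $p_0m$ of $A$ is identified with the edge $n\omega$ of $B$. A \emph{model of a $K_6$ minor} in a graph $G$ consists of six pairwise disjoint, non-empty vertex sets, each inducing a connected subgraph of $G$, such that for any two of them $G$ has an edge with one end in each. \textbf{Theorem.} For every integer $R \ge 0$, the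 $R$-counterwall $G_R$ (with either choice of the shifted rows) does not possess a model of a $K_6$ minor. -/

import Mathlib

/-- A model of an `H`-minor in `G`: pairwise disjoint connected (in particular nonempty) branch
sets, one for each vertex of `H`, such that for every edge of `H` some edge of `G` joins the two
corresponding branch sets. -/
structure MinorModel {W V : Type*} (H : SimpleGraph W) (G : SimpleGraph V) where
  /-- the branch set of a vertex of `H` -/
  branch : W → Set V
  connected : ∀ w, (G.induce (branch w)).Connected
  disjoint : ∀ u w, u ≠ w → Disjoint (branch u) (branch w)
  model_edge : ∀ u w, H.Adj u w → ∃ x ∈ branch u, ∃ y ∈ branch w, G.Adj x y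

namespace Counterwall

/-- Vertices are named by their position in a drawing of the counterwall: a brick is 10 units wide
and one unit high.  A brick is named by its bottom left corner. -/
abbrev Point : Type := ℤ × ℤ

/-- The ten vertices of the full brick with bottom left corner `(a, y)`.  The bottom path has, in
addition to the two corners, a middle vertex `(a + 5, y)` and the vertices `α, β, γ, δ` at
`a + 6, a + 7, a + 8, a + 9`; the top right corner `(a + 10, y + 1)` is `ω`. -/
inductive BrickVertex (a y : ℤ) : Point → Prop
  | bottomLeft : BrickVertex a y (a, y)
  | bottomMiddle : BrickVertex a y (a + 5, y)
  | alpha : BrickVertex a y (a + 6, y)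
  | beta : BrickVertex a y (a + 7, y)
  | gamma : BrickVertex a y (a + 8, y)
  | delta : BrickVertex a y (a + 9, y)
  | bottomRight : BrickVertex a y (a + 10, y)
  | topLeft : BrickVertex a y (a, y + 1)
  | topMiddle : BrickVertex a y (a + 5, y + 1)
  | omega : BrickVertex a y (a + 10, y + 1)

/-- The edges of the full brick with bottom left corner `(a, y)`, except for the left half of its
top path. -/
inductive BrickEdge (a y : ℤ) : Point → Point → Prop
  -- the bottom path
  | bottom₁ : BrickEdge a y (a, y) (a + 5, y)
  | bottom₂ : BrickEdge a y (a + 5, y) (a + 6, y)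
  | bottom₃ : BrickEdge a y (a + 6, y) (a + 7, y)
  | bottom₄ : BrickEdge a y (a + 7, y) (a + 8, y)
  | bottom₅ : BrickEdge a y (a + 8, y) (a + 9, y)
  | bottom₆ : BrickEdge a y (a + 9, y) (a + 10, y)
  -- the two sides and the right half of the top path
  | left : BrickEdge a y (a, y) (a, y + 1)
  | right : BrickEdge a y (a + 10, y) (a + 10, y + 1)
  | topRight : BrickEdge a y (a + 5, y + 1) (a + 10, y + 1)
  -- the four edges at `ω`
  | omega_alpha : BrickEdge a y (a + 10, y + 1) (a + 6, y)
  | omega_beta : BrickEdge a y (a + 10, y + 1) (a + 7, y)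
  | omega_gamma : BrickEdge a y (a + 10, y + 1) (a + 8, y)
  | omega_delta : BrickEdge a y (a + 10, y + 1) (a + 9, y)
  -- the two crossing edges
  | alpha_gamma : BrickEdge a y (a + 6, y) (a + 8, y)
  | beta_delta : BrickEdge a y (a + 7, y) (a + 9, y)

/-- The edges of the graph obtained by layering full bricks with bottom left corners in `S`.
The left half of the top path of a brick is a single edge unless another brick lies on top of it;
in that case the upper brick determines the shared path, which is the right half
`(a, y + 1), α, β, γ, δ, (a + 5, y + 1)` of the bottom path of the upper brick.  (If a brick lies
over the right half of the top path, then both bricks contribute the same single edge.) -/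
inductive LayerEdge (S : Set Point) : Point → Point → Prop
  | brick {a y : ℤ} {p q : Point} (h : (a, y) ∈ S) (e : BrickEdge a y p q) : LayerEdge S p q
  | topLeft {a y : ℤ} (h : (a, y) ∈ S) (free : (a - 5, y + 1) ∉ S) :
      LayerEdge S (a, y + 1) (a + 5, y + 1)

/-- The vertices of the graph obtained by layering full bricks with bottom left corners in `S`. -/
def layerVertices (S : Set Point) : Set Point :=
  {p | ∃ a y : ℤ, (a, y) ∈ S ∧ BrickVertex a y p}

/-- The graph obtained by layering full bricks with bottom left corners in `S`. -/
def layerGraph (S : Set Point) : SimpleGraph (layerVertices S) :=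
  (SimpleGraph.fromRel (LayerEdge S)).induce (layerVertices S)

/-- The bricks of an `R`-wall: `R` rows of `R` bricks each, where every other row is shifted to the
right by half a brick.  The bottom row is a shifted one if and only if `s` is true. -/
def wallBricks (R : ℕ) (s : Bool) : Set Point :=
  {p | ∃ i j : ℕ, i < R ∧ j < R ∧
    p = (10 * (j : ℤ) + 5 * (((i + s.toNat) % 2 : ℕ) : ℤ), (i : ℤ))}

end Counterwall

/-- The `R`-counterwall `G_R`, in either of the two staggerings of its rows. -/
def counterwall (R : ℕ) (s : Bool) :
    SimpleGraph (Counterwall.layerVertices (Counterwall.wallBricks R s)) :=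
  Counterwall.layerGraph (Counterwall.wallBricks R s)

/-! All neighbours of β and γ lie among α, β, γ, δ, ω (`mem_gadget_of_adj`). A branch set that meets
{β, γ} but avoids α, δ, ω is contained in {β, γ} by connectivity; being adjacent to the other five,
it forces six disjoint sets to meet a gadget of five vertices. So a branch set containing β or γ
also contains α, δ or ω (`exists_anchor`). Replacing β and γ by such an anchor turns a model in the
counterwall into one in a plane graph, where α, δ, ω form a triangle (`joins_of_layerEdge`,
`no_six_model_of_staggered`).

Planarity enters only as algebraic duality: the cycles modulo two are the coboundaries of face
colourings. For the wall, a colouring is built row by row from below (`exists_wall_potential`).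

That a plane graph has no K₆ model is Euler's formula in this language (`false_of_model`). Merge
faces across edges outside the model. The cycle space of K₆ has dimension 10, so face colourings,
with constants added, give 2^11 distinct functions on the merged faces that border a selected edge
an odd number of times; there are at least 11 such faces. Each of them is bounded by a nonzero cycle
of K₆, hence by at least three edges, and each of the 15 edges borders at most two of them; so there
are at most 10. -/

/-! ### Cycles modulo two and abstract plane duality. -/

/-- The boundary map, modulo two, of the multigraph in which the edge `e` joins `s e` and `t e`. -/
noncomputable def edgeBoundary {V E : Type*} (s t : E → V) :
    (E →₀ ZMod 2) →ₗ[ZMod 2] (V →₀ ZMod 2) :=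
  Finsupp.linearCombination (ZMod 2) fun e => Finsupp.single (s e) 1 + Finsupp.single (t e) 1

theorem edgeBoundary_single {V E : Type*} (s t : E → V) (e : E) :
    edgeBoundary s t (Finsupp.single e 1) = Finsupp.single (s e) 1 + Finsupp.single (t e) 1 := by
  simp [edgeBoundary]

/-- A multigraph with two faces assigned to every edge, such that the cycles modulo two are exactly
the finite sets of edges that separate some set of faces from its complement. -/
structure PlaneMultigraph (V E F : Type*) where
  src : E → V
  tgt : E → V
  left : E → F
  right : E → F
  finite_src : ∀ B : Set V, B.Finite → {e | src e ∈ B}.Finite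
  exact : ∀ z : E →₀ ZMod 2, edgeBoundary src tgt z = 0 →
    ∃ c : F → ZMod 2, ∀ e, z e = c (left e) + c (right e)
  closed : ∀ (z : E →₀ ZMod 2) (c : F → ZMod 2), (∀ e, z e = c (left e) + c (right e)) →
    edgeBoundary src tgt z = 0

namespace PlaneMultigraph

variable {V E F : Type*} (P : PlaneMultigraph V E F)

/-- The edge `e` joins `a` and `b`. -/
def Joins (e : E) (a b : V) : Prop :=
  (P.src e = a ∧ P.tgt e = b) ∨ (P.src e = b ∧ P.tgt e = a)

variable {P} in
theorem Joins.symm {e : E} {a b : V} (h : P.Joins e a b) : P.Joins e b a := h.elim Or.inr Or.inl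

theorem boundary_of_joins {e : E} {a b : V} (h : P.Joins e a b) :
    edgeBoundary P.src P.tgt (Finsupp.single e 1) = Finsupp.single a 1 + Finsupp.single b 1 := by
  rw [edgeBoundary_single]
  rcases h with ⟨rfl, rfl⟩ | ⟨rfl, rfl⟩
  · rfl
  · exact add_comm _ _

/-- Some chain of edges inside `B` has boundary `a + b`. -/
def Linked (B : Set V) (a b : V) : Prop :=
  ∃ z : E →₀ ZMod 2, (∀ e, z e ≠ 0 → P.src e ∈ B ∧ P.tgt e ∈ B) ∧
    edgeBoundary P.src P.tgt z = Finsupp.single a 1 + Finsupp.single b 1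

theorem single_add_self (a : V) : Finsupp.single a (1 : ZMod 2) + Finsupp.single a 1 = 0 := by
  rw [← Finsupp.single_add, CharTwo.add_self_eq_zero, Finsupp.single_zero]

theorem Linked.refl (B : Set V) (a : V) : P.Linked B a a :=
  ⟨0, by simp, by rw [map_zero, single_add_self]⟩

variable {P} in
theorem Linked.trans_joins {B : Set V} {a b c : V} {e : E} (h : P.Linked B a b) (hb : b ∈ B)
    (hc : c ∈ B) (he : P.Joins e b c) : P.Linked B a c := by
  obtain ⟨z, hz, hz'⟩ := h
  refine ⟨z + Finsupp.single e 1, fun e' h' => ?_, ?_⟩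
  · by_cases hee : e = e'
    · subst hee
      rcases he with ⟨rfl, rfl⟩ | ⟨rfl, rfl⟩
      · exact ⟨hb, hc⟩
      · exact ⟨hc, hb⟩
    · apply hz
      simpa [Finsupp.single_apply, hee] using h'
  · rw [map_add, hz', P.boundary_of_joins he]
    have := single_add_self b
    calc _ = Finsupp.single a (1 : ZMod 2) + (Finsupp.single b 1 + Finsupp.single b 1)
          + Finsupp.single c 1 := by abel
      _ = _ := by rw [this, add_zero]

/-- The edges inside the sets `B i` and the selected edges between them. -/
def ModelEdge (B : Fin 6 → Set V) (e : Fin 6 → Fin 6 → E) (f : E) : Prop :=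
  (∃ i, P.src f ∈ B i ∧ P.tgt f ∈ B i) ∨ ∃ i j, i ≠ j ∧ f = e i j

section Model

variable {B : Fin 6 → Set V} (hB : ∀ i j, i ≠ j → Disjoint (B i) (B j))
  {e : Fin 6 → Fin 6 → E} {x : Fin 6 → Fin 6 → V} (hx : ∀ i j, i ≠ j → x i j ∈ B i)
  (he : ∀ i j, i ≠ j → P.Joins (e i j) (x i j) (x j i))

include hB in
theorem index_unique {i j : Fin 6} {v : V} (hi : v ∈ B i) (hj : v ∈ B j) : i = j := by
  by_contra h
  exact (Set.disjoint_left.1 (hB i j h)) hi hj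

include hB hx he in
theorem edge_index_unique {i j k l : Fin 6} (hij : i ≠ j) (hkl : k ≠ l) (h : e i j = e k l) :
    (i = k ∧ j = l) ∨ (i = l ∧ j = k) := by
  have h1 := he i j hij
  have h2 := he k l hkl
  rw [h] at h1
  have a1 := hx i j hij
  have a2 := hx j i hij.symm
  have a3 := hx k l hkl
  have a4 := hx l k hkl.symm
  have key : (x i j = x k l ∧ x j i = x l k) ∨ (x i j = x l k ∧ x j i = x k l) := by
    rcases h1 with ⟨p, q⟩ | ⟨p, q⟩ <;> rcases h2 with ⟨p', q'⟩ | ⟨p', q'⟩ <;> simp_all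
  rcases key with ⟨p, q⟩ | ⟨p, q⟩ <;> rw [p] at a1 <;> rw [q] at a2
  · exact Or.inl ⟨index_unique hB a1 a3, index_unique hB a2 a4⟩
  · exact Or.inr ⟨index_unique hB a1 a4, index_unique hB a2 a3⟩

include hB hx he in
theorem edge_not_inside {i j k : Fin 6} (hij : i ≠ j) :
    ¬ (P.src (e i j) ∈ B k ∧ P.tgt (e i j) ∈ B k) := by
  rintro ⟨h1, h2⟩
  have a1 := hx i j hij
  have a2 := hx j i hij.symm
  rcases he i j hij with ⟨p, q⟩ | ⟨p, q⟩ <;> rw [p] at h1 <;> rw [q] at h2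
  · exact hij ((index_unique hB a1 h1).trans (index_unique hB a2 h2).symm)
  · exact hij ((index_unique hB a1 h2).trans (index_unique hB a2 h1).symm)

include hB hx he in
/-- The triangle on `i, j, k` lifts to a cycle. -/
theorem exists_triangle (hL : ∀ i, ∀ a ∈ B i, ∀ b ∈ B i, P.Linked (B i) a b) {i j k : Fin 6}
    (hij : i ≠ j) (hjk : j ≠ k) (hik : i ≠ k) :
    ∃ z : E →₀ ZMod 2, edgeBoundary P.src P.tgt z = 0 ∧ (∀ f, z f ≠ 0 → P.ModelEdge B e f) ∧
      z (e j k) = 1 ∧ ∀ l m, i ≠ l → i ≠ m → l ≠ m → e l m ≠ e j k → z (e l m) = 0 := by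
  obtain ⟨zi, hzi, hzi'⟩ := hL i _ (hx i j hij) _ (hx i k hik)
  obtain ⟨zj, hzj, hzj'⟩ := hL j _ (hx j i hij.symm) _ (hx j k hjk)
  obtain ⟨zk, hzk, hzk'⟩ := hL k _ (hx k i hik.symm) _ (hx k j hjk.symm)
  have zero : ∀ l m, l ≠ m → zi (e l m) = 0 ∧ zj (e l m) = 0 ∧ zk (e l m) = 0 := by
    intro l m hlm
    refine ⟨?_, ?_, ?_⟩ <;> by_contra h
    · exact P.edge_not_inside hB hx he hlm (hzi _ h)
    · exact P.edge_not_inside hB hx he hlm (hzj _ h)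
    · exact P.edge_not_inside hB hx he hlm (hzk _ h)
  have diff : ∀ l m p, i ≠ l → i ≠ m → l ≠ m → i ≠ p → e i p ≠ e l m := by
    intro l m p hl hm hlm hp h
    rcases P.edge_index_unique hB hx he hp hlm h with h | h
    · exact hl h.1
    · exact hm h.1
  -- The three selected edges are closed up by one chain inside each branch set; every endpoint then
  -- occurs twice in the boundary.
  refine ⟨zi + zj + zk + Finsupp.single (e i j) 1 + Finsupp.single (e j k) 1
    + Finsupp.single (e i k) 1, ?_, ?_, ?_, ?_⟩
  · simp only [map_add, hzi', hzj', hzk', P.boundary_of_joins (he _ _ hij),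
      P.boundary_of_joins (he _ _ hjk), P.boundary_of_joins (he _ _ hik)]
    calc _ = (Finsupp.single (x i j) (1 : ZMod 2) + Finsupp.single (x i j) 1)
          + (Finsupp.single (x i k) 1 + Finsupp.single (x i k) 1)
          + (Finsupp.single (x j i) 1 + Finsupp.single (x j i) 1)
          + (Finsupp.single (x j k) 1 + Finsupp.single (x j k) 1)
          + (Finsupp.single (x k i) 1 + Finsupp.single (x k i) 1)
          + (Finsupp.single (x k j) 1 + Finsupp.single (x k j) 1) := by abel
      _ = 0 := by simp only [single_add_self, add_zero]
  · intro f hf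
    by_contra hn
    apply hf
    have n1 : zi f = 0 := by by_contra h; exact hn (Or.inl ⟨i, hzi _ h⟩)
    have n2 : zj f = 0 := by by_contra h; exact hn (Or.inl ⟨j, hzj _ h⟩)
    have n3 : zk f = 0 := by by_contra h; exact hn (Or.inl ⟨k, hzk _ h⟩)
    have n4 : e i j ≠ f := fun h => hn (Or.inr ⟨i, j, hij, h.symm⟩)
    have n5 : e j k ≠ f := fun h => hn (Or.inr ⟨j, k, hjk, h.symm⟩)
    have n6 : e i k ≠ f := fun h => hn (Or.inr ⟨i, k, hik, h.symm⟩)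
    simp [n1, n2, n3, n4, n5, n6]
  · have h1 := diff j k j hij hik hjk hij
    have h2 := diff j k k hij hik hjk hik
    simp [zero j k hjk, h1, h2]
  · intro l m hl hm hlm hne
    have h1 := diff l m j hl hm hlm hij
    have h2 := diff l m k hl hm hlm hik
    simp [zero l m hlm, h1, h2, hne.symm]

include hB hx he in
/-- A cycle of the model induces a cycle of the complete graph. -/
theorem sum_edges_eq_zero (hs : ∀ i j, i ≠ j → e i j = e j i) (z : E →₀ ZMod 2)
    (hz : edgeBoundary P.src P.tgt z = 0) (hzH : ∀ f, z f ≠ 0 → P.ModelEdge B e f) (i : Fin 6) :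
    ∑ j ∈ Finset.univ.erase i, z (e i j) = 0 := by
  classical
  -- Pairing the boundary with the indicator of `B i`: an edge inside a branch set counts zero or
  -- two times, a selected edge counts once exactly if `i` is one of its indices.
  let g : V → ZMod 2 := fun v => if v ∈ B i then 1 else 0
  have key : z.sum (fun f a => a * (g (P.src f) + g (P.tgt f))) = 0 := by
    have := congrArg (Finsupp.linearCombination (ZMod 2) g) hz
    have hsum : edgeBoundary P.src P.tgt z = z.sum fun f a =>
        a • (Finsupp.single (P.src f) 1 + Finsupp.single (P.tgt f) 1) :=
      Finsupp.linearCombination_apply _ _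
    rw [map_zero, hsum, map_finsuppSum] at this
    simpa [mul_add] using this
  have inj : Set.InjOn (e i) (Finset.univ.erase i : Finset (Fin 6)) := by
    intro j hj k hk h
    simp only [Finset.coe_erase, Finset.coe_univ, Set.mem_sdiff, Set.mem_univ, true_and,
      Set.mem_singleton_iff] at hj hk
    rcases P.edge_index_unique hB hx he (Ne.symm hj) (Ne.symm hk) h with h | h
    · exact h.2
    · exact (hk h.1.symm).elim
  have val : ∀ j, i ≠ j → g (P.src (e i j)) + g (P.tgt (e i j)) = 1 := by
    intro j hij
    have a1 := hx i j hij
    have a2 : x j i ∉ B i := fun h => hij (index_unique hB h (hx j i hij.symm))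
    rcases he i j hij with ⟨p, q⟩ | ⟨p, q⟩ <;> simp [g, p, q, a1, a2]
  -- Neither the support of `z` nor the set of edges `e i j` need contain the other, so the sum
  -- passes through their union.
  rw [Finsupp.sum, Finset.sum_subset (Finset.subset_union_left
    (s₂ := (Finset.univ.erase i).image (e i)))] at key
  · rw [← Finset.sum_subset Finset.subset_union_right, Finset.sum_image inj] at key
    · rw [← key]
      refine Finset.sum_congr rfl fun j hj => ?_
      rw [val j (Finset.ne_of_mem_erase hj).symm, mul_one]
    · intro f hf hni
      by_cases h0 : z f = 0
      · simp [h0]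
      rcases hzH f h0 with ⟨k, hk⟩ | ⟨k, l, hkl, rfl⟩
      · have : g (P.src f) = g (P.tgt f) := by
          by_cases hik : i = k
          · subst hik
            simp [g, hk.1, hk.2]
          · have h1 : P.src f ∉ B i := fun h => hik (index_unique hB h hk.1)
            have h2 : P.tgt f ∉ B i := fun h => hik (index_unique hB h hk.2)
            simp [g, h1, h2]
        rw [this, CharTwo.add_self_eq_zero, mul_zero]
      · have h1 : i ≠ k := by
          rintro rfl
          exact hni (Finset.mem_image_of_mem _ (by simp [hkl.symm]))
        have h2 : i ≠ l := by
          rintro rfl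
          exact hni (Finset.mem_image.2 ⟨k, by simp [hkl], hs _ _ hkl.symm⟩)
        have b1 : x k l ∉ B i := fun h => h1 (index_unique hB h (hx k l hkl))
        have b2 : x l k ∉ B i := fun h => h2 (index_unique hB h (hx l k hkl.symm))
        rcases he k l hkl with ⟨p, q⟩ | ⟨p, q⟩ <;> simp [g, p, q, b1, b2]
  · intro f _ hf
    simp [Finsupp.notMem_support_iff.1 hf]

end Model

end PlaneMultigraph

/-! ### Counting faces: a plane graph has no K₆ model. -/

/-- A nonzero cycle modulo two in the complete graph has at least three edges. -/
theorem six_le_card_of_even {w : Fin 6 → Fin 6 → ZMod 2} (hsymm : ∀ i j, w i j = w j i)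
    (hdiag : ∀ i, w i i = 0) (hrow : ∀ i, ∑ j, w i j = 0) {i j : Fin 6} (hij : w i j ≠ 0) :
    6 ≤ (Finset.univ.filter fun p : Fin 6 × Fin 6 => w p.1 p.2 ≠ 0).card := by
  have other : ∀ a b, w a b ≠ 0 → ∃ c, c ≠ b ∧ w a c ≠ 0 := by
    intro a b hab
    by_contra! h
    have := hrow a
    rw [Finset.sum_eq_single b (fun c _ hc => h c hc) (by simp)] at this
    exact hab this
  have ne : ∀ a b, w a b ≠ 0 → a ≠ b := by
    rintro a b h rfl
    exact h (hdiag a)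
  -- Even degree at both ends of `ij` yields edges `ik` and `jm`. Possibly `k = m`, but the three
  -- edges are distinct, giving six ordered pairs.
  obtain ⟨k, hkj, hk⟩ := other i j hij
  obtain ⟨m, hmi, hm⟩ := other j i (by rwa [hsymm])
  have n1 := ne _ _ hij
  have n2 := ne _ _ hk
  have n3 := ne _ _ hm
  have hsub : ({(i, j), (j, i), (i, k), (k, i), (j, m), (m, j)} : Finset (Fin 6 × Fin 6)) ⊆
      Finset.univ.filter fun p : Fin 6 × Fin 6 => w p.1 p.2 ≠ 0 := by
    intro p hp
    simp only [Finset.mem_insert, Finset.mem_singleton] at hp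
    rw [Finset.mem_filter]
    refine ⟨Finset.mem_univ _, ?_⟩
    rcases hp with rfl | rfl | rfl | rfl | rfl | rfl
    · exact hij
    · exact hsymm i j ▸ hij
    · exact hk
    · exact hsymm i k ▸ hk
    · exact hm
    · exact hsymm j m ▸ hm
  refine le_trans (le_of_eq ?_) (Finset.card_le_card hsub)
  have n4 : k ≠ i := n2.symm
  have n5 : j ≠ i := n1.symm
  have n6 : m ≠ j := n3.symm
  simp [Finset.card_insert_of_notMem, Prod.ext_iff, n1, n2, n3, n4, n5, n6, hkj, hkj.symm,
    hmi.symm]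

namespace PlaneMultigraph

variable {V E F : Type*} (P : PlaneMultigraph V E F)

/-- The pairs of vertices of `K₆` other than `0`. -/
abbrev OppositePair : Type := {p : Fin 6 × Fin 6 // 0 < p.1 ∧ p.1 < p.2}

theorem card_oppositePair : Fintype.card OppositePair = 10 := by decide

section Model

variable {B : Fin 6 → Set V} (hB : ∀ i j, i ≠ j → Disjoint (B i) (B j))
  {e : Fin 6 → Fin 6 → E} {x : Fin 6 → Fin 6 → V} (hx : ∀ i j, i ≠ j → x i j ∈ B i)
  (he : ∀ i j, i ≠ j → P.Joins (e i j) (x i j) (x j i))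

include hx he in
theorem finite_modelEdge (hfin : ∀ i, (B i).Finite) : {f | P.ModelEdge B e f}.Finite := by
  refine (P.finite_src (⋃ i, B i) (Set.finite_iUnion hfin)).subset ?_
  rintro f (⟨i, hi, -⟩ | ⟨i, j, hij, rfl⟩)
  · exact Set.mem_iUnion.2 ⟨i, hi⟩
  · rcases he i j hij with ⟨p, -⟩ | ⟨p, -⟩ <;> rw [Set.mem_ofPred_eq, p]
    · exact Set.mem_iUnion.2 ⟨i, hx i j hij⟩
    · exact Set.mem_iUnion.2 ⟨j, hx j i hij.symm⟩

/-- Two faces are merged if an edge outside the model separates them. -/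
def MergedFaces (B : Fin 6 → Set V) (e : Fin 6 → Fin 6 → E) (f g : F) : Prop :=
  ∃ d, ¬ P.ModelEdge B e d ∧ P.left d = f ∧ P.right d = g

open Classical in
/-- The edges of the model between different branch sets on the boundary of a merged face. -/
noncomputable def mergedBoundary (B : Fin 6 → Set V) (e : Fin 6 → Fin 6 → E)
    (q : Quot (P.MergedFaces B e)) (i j : Fin 6) : ZMod 2 :=
  if i = j then 0 else
    (if Quot.mk _ (P.left (e i j)) = q then 1 else 0) +
      (if Quot.mk _ (P.right (e i j)) = q then 1 else 0)

-- The coboundary of the indicator of `q` vanishes off the model, since merging makes both sides of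
-- such an edge equal. Finiteness of the branch sets makes it a finite chain, hence a cycle, to
-- which `sum_edges_eq_zero` applies.
include hB hx he in
theorem mergedBoundary_row (hfin : ∀ i, (B i).Finite) (hs : ∀ i j, i ≠ j → e i j = e j i)
    (q : Quot (P.MergedFaces B e)) (i : Fin 6) : ∑ j, P.mergedBoundary B e q i j = 0 := by
  classical
  let c : F → ZMod 2 := fun f => if Quot.mk _ f = q then 1 else 0
  have hzero : ∀ f, ¬ P.ModelEdge B e f → c (P.left f) + c (P.right f) = 0 := by
    intro f hf
    have : Quot.mk (P.MergedFaces B e) (P.left f) = Quot.mk _ (P.right f) :=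
      Quot.sound ⟨f, hf, rfl, rfl⟩
    simp only [c, this]
    exact CharTwo.add_self_eq_zero _
  let z : E →₀ ZMod 2 := Finsupp.onFinset (P.finite_modelEdge hx he hfin).toFinset
    (fun f => c (P.left f) + c (P.right f)) (fun f hf => by
      rw [Set.Finite.mem_toFinset]
      by_contra h
      exact hf (hzero f h))
  have hz : ∀ f, z f = c (P.left f) + c (P.right f) := fun f => rfl
  have := P.sum_edges_eq_zero hB hx he hs z (P.closed z c hz) (fun f hf => by
    by_contra h
    exact hf ((hz f).trans (hzero f h))) i
  rw [← Finset.sum_erase_add _ _ (Finset.mem_univ i), ← this]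
  simp only [mergedBoundary, if_true, add_zero]
  refine Finset.sum_congr rfl fun j hj => ?_
  rw [if_neg (Finset.ne_of_mem_erase hj).symm, hz]

-- The triangles through `0` form a basis of the cycle space of K₆, dual to the edges avoiding `0`.
-- A combination of their lifts is supported on the model, so its face colouring is constant across
-- all other edges and descends to merged faces.
include hB hx he in
theorem exists_potential (hL : ∀ i, ∀ a ∈ B i, ∀ b ∈ B i, P.Linked (B i) a b)
    (b : OppositePair → ZMod 2) : ∃ c : Quot (P.MergedFaces B e) → ZMod 2,
      ∀ p : OppositePair, c (Quot.mk _ (P.left (e p.1.1 p.1.2))) +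
        c (Quot.mk _ (P.right (e p.1.1 p.1.2))) = b p := by
  have tri : ∀ p : OppositePair, ∃ z : E →₀ ZMod 2, edgeBoundary P.src P.tgt z = 0 ∧
      (∀ f, z f ≠ 0 → P.ModelEdge B e f) ∧ ∀ p' : OppositePair,
        z (e p'.1.1 p'.1.2) = if p' = p then 1 else 0 := by
    rintro ⟨⟨j, k⟩, hj, hjk⟩
    dsimp only at hj hjk
    obtain ⟨z, h1, h2, h3, h4⟩ := P.exists_triangle hB hx he hL hj.ne hjk.ne (hj.trans hjk).ne
    refine ⟨z, h1, h2, ?_⟩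
    rintro ⟨⟨l, m⟩, hl, hlm⟩
    dsimp only at hl hlm
    by_cases h : l = j ∧ m = k
    · obtain ⟨rfl, rfl⟩ := h
      simp [h3]
    · rw [h4 l m hl.ne (hl.trans hlm).ne hlm.ne, if_neg]
      · simpa [Subtype.ext_iff, Prod.ext_iff] using h
      · intro heq
        rcases P.edge_index_unique hB hx he hlm.ne hjk.ne heq with h' | ⟨rfl, rfl⟩
        · exact h h'
        · exact absurd hlm hjk.not_gt
  choose T hT1 hT2 hT3 using tri
  obtain ⟨c, hc⟩ := P.exact (∑ p, b p • T p) (by simp [map_sum, hT1])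
  have hzero : ∀ f, ¬ P.ModelEdge B e f → (∑ p, b p • T p) f = 0 := by
    intro f hf
    rw [Finsupp.finsetSum_apply]
    refine Finset.sum_eq_zero fun p _ => ?_
    have : T p f = 0 := by
      by_contra h
      exact hf (hT2 p f h)
    simp [this]
  refine ⟨Quot.lift c ?_, fun p => ?_⟩
  · rintro f g ⟨d, hd, rfl, rfl⟩
    have := hzero d hd
    rw [hc] at this
    exact CharTwo.add_eq_zero.1 this
  · rw [← hc, Finsupp.finsetSum_apply]
    simp [hT3]

include hB hx he in
theorem false_of_model (hfin : ∀ i, (B i).Finite)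
    (hL : ∀ i, ∀ a ∈ B i, ∀ b ∈ B i, P.Linked (B i) a b)
    (hs : ∀ i j, i ≠ j → e i j = e j i) : False := by
  classical
  let Q := Quot (P.MergedFaces B e)
  let L : Fin 6 → Fin 6 → Q := fun i j => Quot.mk _ (P.left (e i j))
  let R : Fin 6 → Fin 6 → Q := fun i j => Quot.mk _ (P.right (e i j))
  let st : Q → Fin 6 → Fin 6 → ZMod 2 := P.mergedBoundary B e
  have hst : ∀ q i j, i ≠ j →
      st q i j = (if L i j = q then 1 else 0) + (if R i j = q then 1 else 0) := by
    intro q i j hij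
    simp only [st, mergedBoundary, if_neg hij]
    rfl
  let N : Finset Q := (Finset.univ.image (fun p : Fin 6 × Fin 6 => L p.1 p.2) ∪
    Finset.univ.image (fun p : Fin 6 × Fin 6 => R p.1 p.2)).filter fun q => ∃ i j, st q i j ≠ 0
  have lower : ∀ q ∈ N,
      6 ≤ (Finset.univ.filter fun p : Fin 6 × Fin 6 => st q p.1 p.2 ≠ 0).card := by
    intro q hq
    obtain ⟨i, j, hij⟩ := (Finset.mem_filter.1 hq).2
    refine six_le_card_of_even (fun i j => ?_) (fun i => ?_)
      (P.mergedBoundary_row hB hx he hfin hs q) hij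
    · by_cases h : i = j
      · rw [h]
      · rw [hst _ _ _ h, hst _ _ _ (Ne.symm h)]
        simp only [L, R, hs i j h]
    · simp [st, mergedBoundary]
  have upper : ∀ p : Fin 6 × Fin 6,
      (N.filter fun q => st q p.1 p.2 ≠ 0).card ≤ if p.1 = p.2 then 0 else 2 := by
    intro p
    split_ifs with h
    · simp [st, mergedBoundary, h]
    · refine (Finset.card_le_card (t := {L p.1 p.2, R p.1 p.2}) fun q hq => ?_).trans
        Finset.card_le_two
      have := (Finset.mem_filter.1 hq).2
      rw [hst _ _ _ h] at this
      by_contra hn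
      simp only [Finset.mem_insert, Finset.mem_singleton, not_or] at hn
      exact this (by simp [Ne.symm hn.1, Ne.symm hn.2])
  -- Double counting incidences: 30 ordered pairs of distinct indices, at most two faces each.
  have hcard : N.card * 6 ≤ 60 := by
    calc N.card * 6 ≤ ∑ q ∈ N,
          (Finset.univ.filter fun p : Fin 6 × Fin 6 => st q p.1 p.2 ≠ 0).card := by
          simpa using Finset.card_nsmul_le_sum N _ 6 lower
      _ = ∑ p : Fin 6 × Fin 6, (N.filter fun q => st q p.1 p.2 ≠ 0).card :=
          Finset.sum_card_bipartiteAbove_eq_sum_card_bipartiteBelow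
            (fun q (p : Fin 6 × Fin 6) => st q p.1 p.2 ≠ 0)
      _ ≤ ∑ p : Fin 6 × Fin 6, if p.1 = p.2 then 0 else 2 := Finset.sum_le_sum fun p _ => upper p
      _ = 60 := by decide
  choose c hc using P.exists_potential hB hx he hL
  have hN : ∀ i j, i ≠ j → L i j ≠ R i j → L i j ∈ N ∧ R i j ∈ N := by
    intro i j hij hne
    refine ⟨Finset.mem_filter.2 ⟨?_, i, j, ?_⟩, Finset.mem_filter.2 ⟨?_, i, j, ?_⟩⟩
    · exact Finset.mem_union_left _ (Finset.mem_image.2 ⟨(i, j), Finset.mem_univ _, rfl⟩)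
    · simp [hst _ _ _ hij, hne.symm]
    · exact Finset.mem_union_right _ (Finset.mem_image.2 ⟨(i, j), Finset.mem_univ _, rfl⟩)
    · simp [hst _ _ _ hij, hne]
  -- The colouring for the all-ones vector takes different values on the two sides.
  have hne : ∀ p : OppositePair, L p.1.1 p.1.2 ≠ R p.1.1 p.1.2 := by
    intro p h
    have := hc (fun _ => 1) p
    change c _ (L p.1.1 p.1.2) + c _ (R p.1.1 p.1.2) = 1 at this
    rw [h, CharTwo.add_self_eq_zero] at this
    exact zero_ne_one this
  -- The sum over the two sides of an edge cancels the constant `ε` and recovers `b`; then any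
  -- single value recovers `ε`.
  let Φ : (OppositePair → ZMod 2) × ZMod 2 → (N → ZMod 2) := fun b q => c b.1 q + b.2
  have hΦ : Function.Injective Φ := by
    rintro ⟨b, ε⟩ ⟨b', ε'⟩ h
    have val : ∀ q ∈ N, c b q + ε = c b' q + ε' := fun q hq => congrFun h ⟨q, hq⟩
    have hb : b = b' := by
      funext p
      obtain ⟨h1, h2⟩ := hN p.1.1 p.1.2 p.2.2.ne (hne p)
      have v1 := val _ h1
      have v2 := val _ h2
      have e1 : c b (L p.1.1 p.1.2) + c b (R p.1.1 p.1.2) = b p := hc b p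
      have e2 : c b' (L p.1.1 p.1.2) + c b' (R p.1.1 p.1.2) = b' p := hc b' p
      have d1 : ε + ε = 0 := CharTwo.add_self_eq_zero _
      have d2 : ε' + ε' = 0 := CharTwo.add_self_eq_zero _
      linear_combination v1 + v2 - e1 + e2 - d1 + d2
    subst hb
    let p : OppositePair := ⟨(1, 2), by decide⟩
    have := val _ (hN p.1.1 p.1.2 p.2.2.ne (hne p)).1
    rw [add_left_cancel this]
  have := Fintype.card_le_of_injective Φ hΦ
  rw [Fintype.card_prod, Fintype.card_fun, Fintype.card_fun, ZMod.card, card_oppositePair,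
    Fintype.card_coe, ← pow_succ] at this
  have := (Nat.pow_le_pow_iff_right (by norm_num)).1 this
  omega

end Model

/-- A plane multigraph has no model of `K₆`. -/
theorem no_six_model (B : Fin 6 → Set V) (hB : ∀ i j, i ≠ j → Disjoint (B i) (B j))
    (hfin : ∀ i, (B i).Finite) (hL : ∀ i, ∀ a ∈ B i, ∀ b ∈ B i, P.Linked (B i) a b)
    (hE : ∀ i j, i ≠ j → ∃ a ∈ B i, ∃ b ∈ B j, ∃ e, P.Joins e a b) : False := by
  obtain ⟨a, -, -, -, b, -⟩ := hE 0 1 (by decide)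
  have : Nonempty V := ⟨a⟩
  have : Nonempty E := ⟨b⟩
  choose! f hf g hg d hd using hE
  -- The edges chosen for `(i, j)` and `(j, i)` may differ; keeping the one for the increasing pair
  -- makes the selection symmetric.
  refine P.false_of_model hB (e := fun i j => if i < j then d i j else d j i)
    (x := fun i j => if i < j then f i j else g j i) (fun i j hij => ?_) (fun i j hij => ?_)
    hfin hL (fun i j hij => ?_)
  · split_ifs with h
    · exact hf i j hij
    · exact hg j i hij.symm
  · rcases lt_or_gt_of_ne hij with h | h
    · simpa [h, h.not_gt] using hd i j hij
    · simpa [h, h.not_gt] using (hd j i hij.symm).symm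
  · rcases lt_or_gt_of_ne hij with h | h <;> simp [h, h.not_gt]

end PlaneMultigraph

/-! ### The planar wall and its duality. -/

namespace Counterwall

/-- The edges of the planar wall with offset `σ`, whose vertices are the integer points. -/
inductive WallEdge : Type
  | path (u y : ℤ)
  | chord (k y : ℤ)
  | spoke (u y : ℤ)

/-- The faces of the planar wall: `cell u y` lies above `path u y`, and `lune k y` lies between
`chord k y` and the path. -/
inductive WallFace : Type
  | cell (u y : ℤ)
  | lune (k y : ℤ)

open WallEdge WallFace Finsupp

def wallSrc : WallEdge → ℤ × ℤ
  | path u y => (u, y)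
  | chord k y => (3 * k, y)
  | spoke u y => (u, y)

/-- The spoke at `(u, y)` leads to the first corner at or after `u` in the next row. -/
def wallTgt (σ : ℤ) : WallEdge → ℤ × ℤ
  | path u y => (u + 1, y)
  | chord k y => (3 * k + 3, y)
  | spoke u y => (u + (3 * (y + σ) - u) % 6, y + 1)

/-- The last corner at or before `u` of the bricks below row `y`. -/
def cornerBelow (σ u y : ℤ) : ℤ := u - (u - 3 * (y - 1 + σ)) % 6

/-- The spokes of a brick cut off triangular cells at its top right corner; only the cell at its
left corner reaches the chords above. -/
def wallLeft (σ : ℤ) : WallEdge → WallFace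
  | path u y => lune (u / 3) y
  | chord k y => cell (cornerBelow σ (3 * k) y) (y - 1)
  | spoke u y => cell (u - 1) y

def wallRight : WallEdge → WallFace
  | path u y => cell u y
  | chord k y => lune k y
  | spoke u y => cell u y

/-- The sum of `z` over the edges at `(u, y)`. -/
def starSum (σ : ℤ) (z : WallEdge → ZMod 2) (u y : ℤ) : ZMod 2 :=
  z (path (u - 1) y) + z (path u y) + z (spoke u y)
    + (if u % 3 = 0 then z (chord (u / 3 - 1) y) + z (chord (u / 3) y) else 0)
    + (if (u - 3 * (y - 1 + σ)) % 6 = 0 then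
        z (spoke u (y - 1)) + z (spoke (u - 1) (y - 1)) + z (spoke (u - 2) (y - 1))
        + z (spoke (u - 3) (y - 1)) + z (spoke (u - 4) (y - 1)) + z (spoke (u - 5) (y - 1)) else 0)

/-- A top corner at `u` receives exactly the spokes starting at `u - 5, …, u` one row below. -/
theorem starSum_single (σ : ℤ) (e : WallEdge) (u y : ℤ) :
    starSum σ (single e (1 : ZMod 2)) u y =
      (single (wallSrc e) 1 + single (wallTgt σ e) 1 : ℤ × ℤ →₀ ZMod 2) (u, y) := by
  classical
  rw [Finsupp.add_apply]
  simp only [starSum, Finsupp.single_apply]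
  rcases e with ⟨a, b⟩ | ⟨a, b⟩ | ⟨a, b⟩ <;>
    simp only [wallSrc, wallTgt, Prod.mk.injEq, path.injEq, chord.injEq, spoke.injEq, reduceCtorEq,
      if_false, add_zero, zero_add, ite_self]
  · rw [add_comm]
    congr 2
    simp only [eq_iff_iff]; omega
  · by_cases h : u % 3 = 0
    · rw [if_pos h, add_comm]
      congr 2 <;> simp only [eq_iff_iff] <;> omega
    · rw [if_neg h, if_neg (by omega), if_neg (by omega), add_zero]
  · congr 1
    by_cases h : (u - 3 * (y - 1 + σ)) % 6 = 0
    · rw [if_pos h]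
      by_cases hb : b = y - 1
      · by_cases ha : a ≤ u ∧ u - 5 ≤ a
        · have ht : a + (3 * (b + σ) - a) % 6 = u ∧ b + 1 = y := by omega
          have hn : ∀ v n : ℤ, n ≠ 0 → v ≠ v - n := by omega
          simp only [if_pos ht]
          obtain h | h | h | h | h | h : a = u ∨ a = u - 1 ∨ a = u - 2 ∨ a = u - 3 ∨ a = u - 4 ∨
            a = u - 5 := by omega
          all_goals subst h; simp [hb, hn]
        · rw [if_neg (by omega)]
          iterate 6 rw [if_neg (by omega)]
          rfl
      · rw [if_neg (by omega)]
        iterate 6 rw [if_neg (by omega)]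
        rfl
    · rw [if_neg h, if_neg (by omega)]

theorem edgeBoundary_apply (σ : ℤ) (z : WallEdge →₀ ZMod 2) (u y : ℤ) :
    edgeBoundary wallSrc (wallTgt σ) z (u, y) = starSum σ z u y := by
  induction z using Finsupp.induction_linear with
  | zero => simp [starSum]
  | add f g hf hg =>
    rw [map_add, Finsupp.add_apply, hf, hg]
    simp only [starSum, Finsupp.add_apply]
    split_ifs <;> ring
  | single e a =>
    have : single e a = a • single e (1 : ZMod 2) := by simp
    rw [this, map_smul, edgeBoundary_single, Finsupp.smul_apply, ← starSum_single]
    simp only [starSum, Finsupp.smul_apply, smul_eq_mul]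
    split_ifs <;> ring

/-- Going around a vertex, each face colour is met on two consecutive edges and cancels. -/
theorem starSum_coboundary (σ : ℤ) (c : WallFace → ZMod 2) (u y : ℤ) :
    starSum σ (fun e => c (wallLeft σ e) + c (wallRight e)) u y = 0 := by
  have d : ∀ a : ZMod 2, a + a = 0 := CharTwo.add_self_eq_zero
  simp only [starSum, wallLeft, wallRight]
  by_cases h3 : u % 3 = 0
  · have e1 : (u - 1) / 3 = u / 3 - 1 := by omega
    have e2 : 3 * (u / 3) = u := by omega
    have e3 : 3 * (u / 3 - 1) = u - 3 := by omega
    rw [if_pos h3, e1, e2, e3]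
    by_cases h6 : (u - 3 * (y - 1 + σ)) % 6 = 0
    · have e4 : cornerBelow σ u y = u := by simp only [cornerBelow]; omega
      have e5 : cornerBelow σ (u - 3) y = u - 5 - 1 := by simp only [cornerBelow]; omega
      have e6 : u - 1 - 1 = u - 2 := by omega
      have e7 : u - 2 - 1 = u - 3 := by omega
      have e8 : u - 3 - 1 = u - 4 := by omega
      have e9 : u - 4 - 1 = u - 5 := by omega
      rw [if_pos h6, e4, e5, e6, e7, e8, e9]
      generalize c (cell u (y - 1)) = x0
      generalize c (cell (u - 1) (y - 1)) = x1
      generalize c (cell (u - 2) (y - 1)) = x2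
      generalize c (cell (u - 3) (y - 1)) = x3
      generalize c (cell (u - 4) (y - 1)) = x4
      generalize c (cell (u - 5) (y - 1)) = x5
      generalize c (cell (u - 5 - 1) (y - 1)) = x6
      generalize c (cell u y) = x7
      generalize c (cell (u - 1) y) = x8
      generalize c (lune (u / 3) y) = x9
      generalize c (lune (u / 3 - 1) y) = x10
      linear_combination d x0 + d x1 + d x2 + d x3 + d x4 + d x5 + d x6 + d x7 + d x8 + d x9
        + d x10
    · have e4 : cornerBelow σ (u - 3) y = cornerBelow σ u y := by simp only [cornerBelow]; omega
      rw [if_neg h6, e4]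
      linear_combination d (c (cell u y)) + d (c (cell (u - 1) y)) + d (c (lune (u / 3) y))
        + d (c (lune (u / 3 - 1) y)) + d (c (cell (cornerBelow σ u y) (y - 1)))
  · have e1 : (u - 1) / 3 = u / 3 := by omega
    rw [if_neg h3, if_neg (by omega), e1]
    linear_combination d (c (cell u y)) + d (c (cell (u - 1) y)) + d (c (lune (u / 3) y))

/-- The potential of the cells in row `Y + n`, computed row by row from the zero potential. -/
def cellPotential (σ : ℤ) (z : WallEdge → ZMod 2) (Y : ℤ) : ℕ → ℤ → ZMod 2
  | 0, _ => 0
  | n + 1, u => cellPotential σ z Y n (cornerBelow σ u (Y + (n + 1 : ℕ)))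
      + z (chord (u / 3) (Y + (n + 1 : ℕ))) + z (path u (Y + (n + 1 : ℕ)))

/-- The recursion already accounts for paths and chords, so only spokes need checking. The star
relation at `u` carries the claim up one row; at a top corner the six spokes from below telescope.
-/
theorem cellPotential_spoke (σ : ℤ) (z : WallEdge → ZMod 2) (Y : ℤ)
    (hz : ∀ u y, starSum σ z u y = 0) (h0 : ∀ u, z (spoke u Y) = 0) (n : ℕ) (u : ℤ) :
    z (spoke u (Y + n)) = cellPotential σ z Y n (u - 1) + cellPotential σ z Y n u := by
  have d : ∀ a : ZMod 2, a + a = 0 := CharTwo.add_self_eq_zero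
  induction n generalizing u with
  | zero => simpa [cellPotential] using h0 u
  | succ n ih =>
    have hst := hz u (Y + (n + 1 : ℕ))
    have hy : Y + ((n + 1 : ℕ) : ℤ) - 1 = Y + n := by push_cast; ring
    simp only [starSum, hy, ih] at hst
    simp only [cellPotential]
    have hc : ∀ v, cornerBelow σ v (Y + (n + 1 : ℕ)) = v - (v - 3 * (Y + n + σ)) % 6 := by
      intro v
      rw [cornerBelow, hy]
    simp only [hc]
    generalize Y + ((n + 1 : ℕ) : ℤ) = y at *
    by_cases h3 : u % 3 = 0
    · have e1 : (u - 1) / 3 = u / 3 - 1 := by omega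
      rw [if_pos h3] at hst
      rw [e1]
      by_cases h6 : (u - 3 * (Y + n + σ)) % 6 = 0
      · have e4 : u - (u - 3 * (Y + n + σ)) % 6 = u := by omega
        have e5 : u - 1 - (u - 1 - 3 * (Y + n + σ)) % 6 = u - 5 - 1 := by omega
        have e6 : u - 1 - 1 = u - 2 := by omega
        have e7 : u - 2 - 1 = u - 3 := by omega
        have e8 : u - 3 - 1 = u - 4 := by omega
        have e9 : u - 4 - 1 = u - 5 := by omega
        rw [if_pos h6, e6, e7, e8, e9] at hst
        rw [e4, e5]
        generalize cellPotential σ z Y n u = x0 at *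
        generalize cellPotential σ z Y n (u - 1) = x1 at *
        generalize cellPotential σ z Y n (u - 2) = x2 at *
        generalize cellPotential σ z Y n (u - 3) = x3 at *
        generalize cellPotential σ z Y n (u - 4) = x4 at *
        generalize cellPotential σ z Y n (u - 5) = x5 at *
        generalize cellPotential σ z Y n (u - 5 - 1) = x6 at *
        linear_combination hst - d x1 - d x2 - d x3 - d x4 - d x5 - d x6 - d x0
          - d (z (path u y)) - d (z (path (u - 1) y)) - d (z (chord (u / 3) y))
          - d (z (chord (u / 3 - 1) y))
      · have e4 : u - 1 - (u - 1 - 3 * (Y + n + σ)) % 6 = u - (u - 3 * (Y + n + σ)) % 6 := by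
          omega
        rw [if_neg h6] at hst
        rw [e4]
        linear_combination hst - d (z (path u y)) - d (z (path (u - 1) y))
          - d (z (chord (u / 3) y)) - d (z (chord (u / 3 - 1) y))
          - d (cellPotential σ z Y n (u - (u - 3 * (Y + n + σ)) % 6))
    · have e1 : (u - 1) / 3 = u / 3 := by omega
      have e4 : u - 1 - (u - 1 - 3 * (Y + n + σ)) % 6 = u - (u - 3 * (Y + n + σ)) % 6 := by
        omega
      rw [if_neg h3, if_neg (by omega)] at hst
      rw [e1, e4]
      linear_combination hst - d (z (path u y)) - d (z (path (u - 1) y))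
          - d (z (chord (u / 3) y)) - d (cellPotential σ z Y n (u - (u - 3 * (Y + n + σ)) % 6))

theorem exists_empty_rows (z : WallEdge →₀ ZMod 2) :
    ∃ Y : ℤ, ∀ u y, y ≤ Y → z (path u y) = 0 ∧ z (chord u y) = 0 ∧ z (spoke u y) = 0 := by
  classical
  let row : WallEdge → ℤ := fun e => (wallSrc e).2
  obtain ⟨Y, hY⟩ := (z.support.image row).bddBelow
  have key : ∀ e, row e ≤ Y - 1 → z e = 0 := by
    intro e he
    by_contra h
    have := hY (Finset.mem_coe.2 (Finset.mem_image_of_mem row (Finsupp.mem_support_iff.2 h)))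
    omega
  exact ⟨Y - 1, fun u y hy => ⟨key _ hy, key _ hy, key _ hy⟩⟩

theorem exists_wall_potential (σ : ℤ) (z : WallEdge →₀ ZMod 2)
    (hz : edgeBoundary wallSrc (wallTgt σ) z = 0) :
    ∃ c : WallFace → ZMod 2, ∀ e, z e = c (wallLeft σ e) + c (wallRight e) := by
  have d : ∀ a : ZMod 2, a + a = 0 := CharTwo.add_self_eq_zero
  have hst : ∀ u y, starSum σ z u y = 0 := by
    intro u y
    rw [← edgeBoundary_apply, hz, Finsupp.zero_apply]
  obtain ⟨Y, hY⟩ := exists_empty_rows z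
  let f : ℤ → ℤ → ZMod 2 := fun u y => cellPotential σ z Y (y - Y).toNat u
  have hf : ∀ u y, f u y = f (cornerBelow σ u y) (y - 1) + z (chord (u / 3) y)
      + z (path u y) := by
    intro u y
    by_cases hy : y ≤ Y
    · have h1 : (y - Y).toNat = 0 := by omega
      have h2 : (y - 1 - Y).toNat = 0 := by omega
      simp only [f, h1, h2, cellPotential, hY _ y hy, add_zero]
    · obtain ⟨n, hn⟩ : ∃ n : ℕ, y = Y + (n + 1 : ℕ) := ⟨(y - Y).toNat - 1, by omega⟩
      have h1 : (y - Y).toNat = n + 1 := by omega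
      have h2 : (y - 1 - Y).toNat = n := by omega
      simp only [f, h1, h2, cellPotential, ← hn]
  have hfs : ∀ u y, z (spoke u y) = f (u - 1) y + f u y := by
    intro u y
    by_cases hy : y ≤ Y
    · have h1 : (y - Y).toNat = 0 := by omega
      simp only [f, h1, cellPotential, hY _ y hy, add_zero]
    · obtain ⟨n, hn⟩ : ∃ n : ℕ, y = Y + n := ⟨(y - Y).toNat, by omega⟩
      have h1 : (y - Y).toNat = n := by omega
      simp only [f, h1]
      rw [hn]
      exact cellPotential_spoke σ z Y hst (fun u => (hY u Y le_rfl).2.2) n u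
  refine ⟨fun F => match F with
    | cell u y => f u y
    | lune k y => f (cornerBelow σ (3 * k) y) (y - 1) + z (chord k y), ?_⟩
  rintro (⟨u, y⟩ | ⟨k, y⟩ | ⟨u, y⟩)
  · have : cornerBelow σ (3 * (u / 3)) y = cornerBelow σ u y := by
      simp only [cornerBelow]
      omega
    simp only [wallLeft, wallRight]
    rw [hf u y, this]
    linear_combination - d (f (cornerBelow σ u y) (y - 1)) - d (z (chord (u / 3) y))
  · simp only [wallLeft, wallRight]
    linear_combination - d (f (cornerBelow σ (3 * k) y) (y - 1))
  · exact hfs u y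

theorem finite_wallSrc (B : Set (ℤ × ℤ)) (hB : B.Finite) : {e | wallSrc e ∈ B}.Finite := by
  refine (((hB.image fun p => path p.1 p.2).union (hB.image fun p => chord (p.1 / 3) p.2)).union
    (hB.image fun p => spoke p.1 p.2)).subset ?_
  rintro (⟨u, y⟩ | ⟨k, y⟩ | ⟨u, y⟩) h
  · exact Or.inl (Or.inl ⟨_, h, rfl⟩)
  · refine Or.inl (Or.inr ⟨_, h, ?_⟩)
    simp [wallSrc]
  · exact Or.inr ⟨_, h, rfl⟩

/-- The planar wall, drawn in the plane. -/
def planarWall (σ : ℤ) : PlaneMultigraph (ℤ × ℤ) WallEdge WallFace where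
  src := wallSrc
  tgt := wallTgt σ
  left := wallLeft σ
  right := wallRight
  finite_src := finite_wallSrc
  exact := exists_wall_potential σ
  closed := by
    intro z c h
    ext ⟨u, y⟩
    rw [edgeBoundary_apply, funext h, starSum_coboundary, Finsupp.zero_apply]

end Counterwall

/-! ### Comparing the counterwall with the planar wall. -/

namespace Counterwall

/-- The position in the counterwall of a vertex of the planar wall. -/
def wallPosition (a : ℤ × ℤ) : Point :=
  (5 * (a.1 / 3) + (if a.1 % 3 = 2 then 4 else a.1 % 3), a.2)

theorem wallPosition_injective : Function.Injective wallPosition := by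
  rintro ⟨u, y⟩ ⟨u', y'⟩ h
  simp only [wallPosition, Prod.mk.injEq] at h ⊢
  obtain ⟨h1, h2⟩ := h
  refine ⟨?_, h2⟩
  split_ifs at h1 <;> omega

/-- The vertices of the planar wall that represent a vertex of the counterwall: the vertices
`α, δ, ω` of a brick for its vertices `β` and `γ`, and the vertex itself otherwise. -/
def IsAnchor (p : Point) (a : ℤ × ℤ) : Prop :=
  (p.1 % 5 = 0 ∧ a.1 = 3 * (p.1 / 5) ∧ a.2 = p.2) ∨
  (p.1 % 5 = 1 ∧ a.1 = 3 * (p.1 / 5) + 1 ∧ a.2 = p.2) ∨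
  (p.1 % 5 = 4 ∧ a.1 = 3 * (p.1 / 5) + 2 ∧ a.2 = p.2) ∨
  ((p.1 % 5 = 2 ∨ p.1 % 5 = 3) ∧
    ((a.1 = 3 * (p.1 / 5) + 1 ∧ a.2 = p.2) ∨ (a.1 = 3 * (p.1 / 5) + 2 ∧ a.2 = p.2) ∨
      (a.1 = 3 * (p.1 / 5) + 3 ∧ a.2 = p.2 + 1)))

theorem isAnchor_wallPosition {a b : ℤ × ℤ} : IsAnchor (wallPosition a) b ↔ b = a := by
  obtain ⟨u, y⟩ := a
  obtain ⟨v, w⟩ := b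
  simp only [IsAnchor, wallPosition, Prod.mk.injEq]
  split_ifs <;> omega

/-- The bricks in `S` are those of a wall with offset `σ`. -/
def IsStaggered (S : Set Point) (σ : ℤ) : Prop :=
  ∀ a y, (a, y) ∈ S → (a - 5 * (y + σ)) % 10 = 0

/-- Adjacency in purely arithmetic form, ready for `omega`. -/
theorem exists_joins_iff {σ : ℤ} {a b : ℤ × ℤ} : (∃ e, (planarWall σ).Joins e a b) ↔
    ((a.2 = b.2 ∧ (b.1 = a.1 + 1 ∨ a.1 = b.1 + 1 ∨ (a.1 % 3 = 0 ∧ b.1 = a.1 + 3) ∨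
      (b.1 % 3 = 0 ∧ a.1 = b.1 + 3))) ∨
    (b.2 = a.2 + 1 ∧ b.1 = a.1 + (3 * (a.2 + σ) - a.1) % 6) ∨
    (a.2 = b.2 + 1 ∧ a.1 = b.1 + (3 * (b.2 + σ) - b.1) % 6)) := by
  obtain ⟨u, y⟩ := a
  obtain ⟨v, w⟩ := b
  constructor
  · rintro ⟨⟨k, l⟩ | ⟨k, l⟩ | ⟨k, l⟩, h⟩ <;>
      simp only [PlaneMultigraph.Joins, planarWall, wallSrc, wallTgt, Prod.mk.injEq] at h <;>
      dsimp only <;> omega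
  · dsimp only
    intro h
    simp only [PlaneMultigraph.Joins, planarWall]
    rcases h with ⟨h, h1 | h1 | h1 | h1⟩ | h | h
    · exact ⟨.path u y, by simp only [wallSrc, wallTgt, Prod.mk.injEq, true_and, and_true]; omega⟩
    · exact ⟨.path v y, by simp only [wallSrc, wallTgt, Prod.mk.injEq, true_and, and_true]; omega⟩
    · exact ⟨.chord (u / 3) y, by simp only [wallSrc, wallTgt, Prod.mk.injEq, and_true]; omega⟩
    · exact ⟨.chord (v / 3) y, by simp only [wallSrc, wallTgt, Prod.mk.injEq, and_true]; omega⟩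
    · exact ⟨.spoke u y, Or.inl ⟨rfl, by simp only [wallTgt, Prod.mk.injEq]; omega⟩⟩
    · exact ⟨.spoke v w, Or.inr ⟨rfl, by simp only [wallTgt, Prod.mk.injEq]; omega⟩⟩

theorem isAnchor_zero {j y : ℤ} {a : ℤ × ℤ} : IsAnchor (5 * j, y) a ↔ a = (3 * j, y) := by
  simp only [IsAnchor, Prod.ext_iff]; omega

theorem isAnchor_one {j y : ℤ} {a : ℤ × ℤ} :
    IsAnchor (5 * j + 1, y) a ↔ a = (3 * j + 1, y) := by
  simp only [IsAnchor, Prod.ext_iff]; omega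

theorem isAnchor_four {j y : ℤ} {a : ℤ × ℤ} :
    IsAnchor (5 * j + 4, y) a ↔ a = (3 * j + 2, y) := by
  simp only [IsAnchor, Prod.ext_iff]; omega

theorem isAnchor_two {j y : ℤ} {a : ℤ × ℤ} : IsAnchor (5 * j + 2, y) a ↔
    a = (3 * j + 1, y) ∨ a = (3 * j + 2, y) ∨ a = (3 * j + 3, y + 1) := by
  have h1 : (5 * j + 2) % 5 = 2 := by omega
  have h2 : (5 * j + 2) / 5 = j := by omega
  simp [IsAnchor, Prod.ext_iff, h1, h2]

theorem isAnchor_three {j y : ℤ} {a : ℤ × ℤ} : IsAnchor (5 * j + 3, y) a ↔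
    a = (3 * j + 1, y) ∨ a = (3 * j + 2, y) ∨ a = (3 * j + 3, y + 1) := by
  have h1 : (5 * j + 3) % 5 = 3 := by omega
  have h2 : (5 * j + 3) / 5 = j := by omega
  simp [IsAnchor, Prod.ext_iff, h1, h2]

/-- Edges at β or γ stay within the gadget, whose anchors α, δ, ω are pairwise joined; every other
edge is a path edge, chord or spoke. The planar wall has all chords, so it does not matter which top
halves are free. -/
theorem joins_of_layerEdge {S : Set Point} {σ : ℤ} (hS : IsStaggered S σ) {p q : Point}
    (h : LayerEdge S p q) {a b : ℤ × ℤ} (ha : IsAnchor p a) (hb : IsAnchor q b) :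
    a = b ∨ ∃ e, (planarWall σ).Joins e a b := by
  rw [exists_joins_iff]
  have brick : ∀ c y, (c, y) ∈ S → ∃ j, c = 5 * j ∧ (3 * (y + σ) - 3 * j) % 6 = 0 := by
    intro c y h
    have := hS c y h
    exact ⟨c / 5, by omega, by omega⟩
  have shift : ∀ j : ℤ, 5 * j + 5 = 5 * (j + 1) ∧ 5 * j + 6 = 5 * (j + 1) + 1 ∧
      5 * j + 7 = 5 * (j + 1) + 2 ∧ 5 * j + 8 = 5 * (j + 1) + 3 ∧ 5 * j + 9 = 5 * (j + 1) + 4 ∧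
      5 * j + 10 = 5 * (j + 2) := by omega
  cases h with
  | @brick c y p q h e =>
    obtain ⟨j, rfl, hj⟩ := brick _ _ h
    obtain ⟨h5, h6, h7, h8, h9, h10⟩ := shift j
    cases e <;>
      simp only [h5, h6, h7, h8, h9, h10, isAnchor_zero, isAnchor_one, isAnchor_two,
        isAnchor_three, isAnchor_four] at ha hb <;>
      clear h h5 h6 h7 h8 h9 h10 shift brick hS
    case alpha_gamma | bottom₃ | omega_beta | omega_gamma =>
      subst ha
      rcases hb with rfl | rfl | rfl <;> simp only [Prod.mk.injEq, true_and, and_true, true_or] <;> omega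
    case beta_delta | bottom₅ =>
      subst hb
      rcases ha with rfl | rfl | rfl <;> simp only [Prod.mk.injEq, true_and, and_true, true_or] <;> omega
    case bottom₄ =>
      rcases ha with rfl | rfl | rfl <;> rcases hb with rfl | rfl | rfl <;>
        simp only [Prod.mk.injEq, true_and, and_true, true_or] <;> omega
    all_goals
      subst ha hb
      simp only [Prod.mk.injEq, true_and, and_true, true_or, or_true] <;> omega
  | @topLeft c y h _ =>
    obtain ⟨j, rfl, hj⟩ := brick _ _ h
    rw [(shift j).1] at hb
    rw [isAnchor_zero] at ha hb
    subst ha hb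
    simp only [Prod.mk.injEq, true_and, and_true]
    omega

theorem joins_of_adj {S : Set Point} {σ : ℤ} (hS : IsStaggered S σ) {p q : Point}
    (h : (SimpleGraph.fromRel (LayerEdge S)).Adj p q) {a b : ℤ × ℤ} (ha : IsAnchor p a)
    (hb : IsAnchor q b) : a = b ∨ ∃ e, (planarWall σ).Joins e a b := by
  rw [SimpleGraph.fromRel_adj] at h
  rcases h.2 with h | h
  · exact joins_of_layerEdge hS h ha hb
  · rcases joins_of_layerEdge hS h hb ha with h | ⟨e, h⟩
    · exact Or.inl h.symm
    · exact Or.inr ⟨e, h.symm⟩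

/-- The vertices `α, β, γ, δ, ω` of the gadget whose vertex `m` is `(5 * k, y)`. -/
def gadget (k y : ℤ) : Finset Point :=
  {(5 * k + 1, y), (5 * k + 2, y), (5 * k + 3, y), (5 * k + 4, y), (5 * k + 5, y + 1)}

theorem card_gadget_le (k y : ℤ) : (gadget k y).card ≤ 5 := Finset.card_le_five

theorem mem_gadget {k y : ℤ} {q : Point} : q ∈ gadget k y ↔
    (5 * k + 1 ≤ q.1 ∧ q.1 ≤ 5 * k + 4 ∧ q.2 = y) ∨ (q.1 = 5 * k + 5 ∧ q.2 = y + 1) := by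
  simp only [gadget, Finset.mem_insert, Finset.mem_singleton, Prod.ext_iff]
  omega

theorem mem_gadget_of_adj {S : Set Point} {σ : ℤ} (hS : IsStaggered S σ) {p q : Point}
    (h : (SimpleGraph.fromRel (LayerEdge S)).Adj p q) {k y : ℤ}
    (hp : p = (5 * k + 2, y) ∨ p = (5 * k + 3, y)) : q ∈ gadget k y := by
  have brick : ∀ c y, (c, y) ∈ S → ∃ j, c = 5 * j := by
    intro c y h
    have := hS c y h
    exact ⟨c / 5, by omega⟩
  rw [mem_gadget]
  rw [SimpleGraph.fromRel_adj] at h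
  simp only [Prod.ext_iff] at hp
  rcases h.2 with (⟨hb, e⟩ | ⟨hb, -⟩) | (⟨hb, e⟩ | ⟨hb, -⟩) <;> clear h <;>
    obtain ⟨j, rfl⟩ := brick _ _ hb <;> clear hb brick
  · cases e <;> dsimp only at hp ⊢ <;> omega
  · dsimp only at hp
    omega
  · cases e <;> dsimp only at hp ⊢ <;> omega
  · dsimp only at hp
    omega

end Counterwall

/-! ### Transferring a model to the planar wall. -/

namespace Counterwall

theorem induction_of_connected {V : Type*} {G : SimpleGraph V} {B : Set V}
    (hB : (G.induce B).Connected) {p q : V} (hp : p ∈ B) (hq : q ∈ B) {M : V → Prop} (h0 : M p)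
    (hstep : ∀ a ∈ B, ∀ b ∈ B, G.Adj a b → M a → M b) : M q := by
  obtain ⟨w⟩ := hB.preconnected ⟨p, hp⟩ ⟨q, hq⟩
  have key : ∀ {a b : B} (_ : (G.induce B).Walk a b), M a → M b := by
    intro a b w
    induction w with
    | nil => exact id
    | cons h _ ih => exact fun ha => ih (hstep _ (Subtype.prop _) _ (Subtype.prop _) h ha)
  exact key w h0

/-- A model of `K₆` in a graph on the points of the plane whose edges come from staggered bricks
contains an anchor of each of its vertices. -/
theorem exists_anchor {S : Set Point} {σ : ℤ} (hS : IsStaggered S σ) {B : Fin 6 → Set Point}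
    (hdisj : ∀ i j, i ≠ j → Disjoint (B i) (B j))
    (hconn : ∀ i, ((SimpleGraph.fromRel (LayerEdge S)).induce (B i)).Connected)
    (hadj : ∀ i j, i ≠ j → ∃ p ∈ B i, ∃ q ∈ B j, (SimpleGraph.fromRel (LayerEdge S)).Adj p q)
    (i : Fin 6) {p : Point} (hp : p ∈ B i) : ∃ a, IsAnchor p a ∧ wallPosition a ∈ B i := by
  classical
  obtain ⟨x, y⟩ := p
  obtain ⟨k, hk⟩ : ∃ k, k = x / 5 := ⟨_, rfl⟩
  have pos1 : wallPosition (3 * k + 1, y) = (5 * k + 1, y) := by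
    simp only [wallPosition, Prod.mk.injEq, and_true]
    split_ifs <;> omega
  have pos2 : wallPosition (3 * k + 2, y) = (5 * k + 4, y) := by
    simp only [wallPosition, Prod.mk.injEq, and_true]
    split_ifs <;> omega
  have pos3 : ∀ l z, wallPosition (3 * l, z) = (5 * l, z) := by
    intro l z
    simp only [wallPosition, Prod.mk.injEq, and_true]
    split_ifs <;> omega
  obtain h | h | h | h | h : x = 5 * k ∨ x = 5 * k + 1 ∨ x = 5 * k + 4 ∨ x = 5 * k + 2 ∨
    x = 5 * k + 3 := by omega
  · exact ⟨(3 * k, y), h ▸ isAnchor_zero.2 rfl, by rwa [pos3, ← h]⟩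
  · exact ⟨(3 * k + 1, y), h ▸ isAnchor_one.2 rfl, by rwa [pos1, ← h]⟩
  · exact ⟨(3 * k + 2, y), h ▸ isAnchor_four.2 rfl, by rwa [pos2, ← h]⟩
  all_goals
    by_contra! hno
    have no : ∀ a, (a = (3 * k + 1, y) ∨ a = (3 * k + 2, y) ∨ a = (3 * (k + 1), y + 1)) →
        wallPosition a ∉ B i := by
      intro a ha
      apply hno
      rw [mul_add, mul_one] at ha
      rw [h]
      first
      | exact isAnchor_two.2 ha
      | exact isAnchor_three.2 ha
    have n1 := no _ (Or.inl rfl)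
    have n2 := no _ (Or.inr (Or.inl rfl))
    have n3 := no _ (Or.inr (Or.inr rfl))
    rw [pos1] at n1
    rw [pos2] at n2
    rw [pos3, mul_add, mul_one] at n3
    have inside : ∀ q ∈ B i, q = (5 * k + 2, y) ∨ q = (5 * k + 3, y) := by
      intro q hq
      refine induction_of_connected (hconn i) hp hq
        (M := fun q => q = (5 * k + 2, y) ∨ q = (5 * k + 3, y)) (by simp [h]) ?_
      intro a _ b hb hab ha
      have := mem_gadget_of_adj hS hab ha
      simp only [gadget, Finset.mem_insert, Finset.mem_singleton] at this
      rcases this with rfl | rfl | rfl | rfl | rfl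
      · exact (n1 hb).elim
      · exact Or.inl rfl
      · exact Or.inr rfl
      · exact (n2 hb).elim
      · exact (n3 hb).elim
    -- The branch set lies in {β, γ}, so any neighbouring branch set is reached inside the gadget.
    have hit : ∀ j, ∃ q ∈ B j, q ∈ gadget k y := by
      intro j
      by_cases hij : i = j
      · subst hij
        refine ⟨_, hp, ?_⟩
        simp [gadget, h]
      · obtain ⟨a, ha, b, hb, hab⟩ := hadj i j hij
        exact ⟨b, hb, mem_gadget_of_adj hS hab (inside a ha)⟩
    choose f hf hf' using hit
    have hinj : Set.InjOn f (Finset.univ : Finset (Fin 6)) := by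
      intro a _ b _ hab
      by_contra hne
      exact Set.disjoint_left.1 (hdisj a b hne) (hf a) (hab ▸ hf b)
    have := Finset.card_le_card_of_injOn f (fun j _ => hf' j) hinj
    have := this.trans (card_gadget_le k y)
    simp at this

theorem no_six_model_of_staggered {S : Set Point} {σ : ℤ} (hS : IsStaggered S σ)
    {B : Fin 6 → Set Point} (hfin : ∀ i, (B i).Finite)
    (hdisj : ∀ i j, i ≠ j → Disjoint (B i) (B j))
    (hconn : ∀ i, ((SimpleGraph.fromRel (LayerEdge S)).induce (B i)).Connected)
    (hadj : ∀ i j, i ≠ j → ∃ p ∈ B i, ∃ q ∈ B j, (SimpleGraph.fromRel (LayerEdge S)).Adj p q) :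
    False := by
  have anchor := fun i p => exists_anchor hS hdisj hconn hadj i (p := p)
  refine (planarWall σ).no_six_model (fun i => wallPosition ⁻¹' B i)
    (fun i j hij => (hdisj i j hij).preimage _)
    (fun i => (hfin i).preimage wallPosition_injective.injOn) ?_ ?_
  · intro i a ha b hb
    -- A walk in the counterwall may pass through β or γ, which have several anchors; the induction
    -- therefore links `a` to every anchor lying in the branch set.
    have key : ∀ c, IsAnchor (wallPosition b) c → wallPosition c ∈ B i →
        (planarWall σ).Linked (wallPosition ⁻¹' B i) a c := by
      refine induction_of_connected (hconn i) ha hb (M := fun q => ∀ c, IsAnchor q c →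
        wallPosition c ∈ B i → (planarWall σ).Linked (wallPosition ⁻¹' B i) a c) ?_ ?_
      · intro c hc _
        rw [isAnchor_wallPosition.1 hc]
        exact PlaneMultigraph.Linked.refl _ _ _
      · intro p hp q _ hpq ih c hc hcB
        obtain ⟨d, hd, hdB⟩ := anchor i p hp
        rcases joins_of_adj hS hpq hd hc with rfl | ⟨e, he⟩
        · exact ih _ hd hdB
        · exact (ih d hd hdB).trans_joins hdB hcB he
    exact key b (isAnchor_wallPosition.2 rfl) hb
  · intro i j hij
    obtain ⟨p, hp, q, hq, hpq⟩ := hadj i j hij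
    obtain ⟨a, ha, haB⟩ := anchor i p hp
    obtain ⟨b, hb, hbB⟩ := anchor j q hq
    refine ⟨a, haB, b, hbB, ?_⟩
    rcases joins_of_adj hS hpq ha hb with rfl | h
    · exact (Set.disjoint_left.1 (hdisj i j hij) haB hbB).elim
    · exact h

theorem isStaggered_wallBricks (R : ℕ) (s : Bool) : IsStaggered (wallBricks R s) s.toNat := by
  rintro a y ⟨i, j, -, -, h⟩
  simp only [Prod.mk.injEq] at h
  omega

theorem finite_layerVertices_wallBricks (R : ℕ) (s : Bool) :
    (layerVertices (wallBricks R s)).Finite := by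
  refine ((Set.finite_Icc (0 : ℤ) (10 * R + 20)).prod (Set.finite_Icc (0 : ℤ) (R + 1))).subset ?_
  rintro p ⟨a, y, ⟨i, j, hi, hj, h⟩, hp⟩
  simp only [Prod.mk.injEq] at h
  cases hp <;> simp only [Set.mem_prod, Set.mem_Icc] <;> omega

end Counterwall

theorem mainTheorem7 (R : ℕ) (s : Bool) :
    ¬ Nonempty (MinorModel (⊤ : SimpleGraph (Fin 6)) (counterwall R s)) := by
  rintro ⟨M⟩
  refine Counterwall.no_six_model_of_staggered (Counterwall.isStaggered_wallBricks R s)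
    (B := fun i => Subtype.val '' M.branch i)
    (fun i => (Counterwall.finite_layerVertices_wallBricks R s).subset (Subtype.coe_image_subset _ _))
    (fun i j hij => (Set.disjoint_image_iff Subtype.val_injective).2 (M.disjoint i j hij))
    (fun i => ?_) (fun i j hij => ?_)
  · let f : (counterwall R s).induce (M.branch i) →g
        (SimpleGraph.fromRel (Counterwall.LayerEdge (Counterwall.wallBricks R s))).induce
          (Subtype.val '' M.branch i) :=
      { toFun := fun p => ⟨p.1.1, p.1, p.2, rfl⟩
        map_rel' := fun h => h }
    refine (M.connected i).map f ?_
    rintro ⟨_, p, hp, rfl⟩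
    exact ⟨⟨p, hp⟩, rfl⟩
  · obtain ⟨p, hp, q, hq, h⟩ := M.model_edge i j hij
    exact ⟨p, ⟨p, hp, rfl⟩, q, ⟨q, hq, rfl⟩, h⟩
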